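/- For a function $\omega:\mathbb Z^2\to\mathbb R$, let $\Sigma(\omega)$ be the regular subdivision with height function $\omega$: the collection of all images, under the projection $\mathbb R^2\times\mathbb R\to\mathbb R^2$ omitting the last coordinate, of the nonempty lower faces (of every dimension) of $\operatorname{conv}\{(a,\omega(a)) : a\in\mathbb Z^2\}$. Here a lower face is the set of points of this convex hull that minimize a linear functional whose coefficient at the last coordinate is positive. Let the honeycomb triangulation of $\mathbb R^2$ be the collection of all closed cells (vertices, edges and triangles) of the line arrangement $\{x=\ell\}$, $\{y=\ell\}$, $\{x+y=\ell\}$, $\ell\in\mathbb Z$; equivalently, it is the image of the alcoved triangulation of the plane, which is cut out by the lines $z_1=\ell$, $z_2=\ell$, $z_1-z_2=\ell$ $(\ell\in\mathbb Z)$, under $\tau(z_1,z_2)=(z_1-z_2,z_2)$. We say that $\omega$ induces the honeycomb triangulation if $\Sigma(\omega)$ equals it. **Theorem.** A function $\omega:\mathbb Z^2\to\mathbb R$ induces the honeycomb triangulation of the entire plane $\mathbb R^2$ if and only if, for all $i,j\in\mathbb Z$, 1. $\omega(i-1,j-1)+\omega(i,j) > \omega(i-1,j)+\omega(i,j-1)$,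 2. $\omega(i-1,j)+\omega(i+1,j-1) > \omega(i,j-1)+\omega(i,j)$, and 3. $\omega(i,j-1)+\omega(i-1,j+1) > \omega(i-1,j)+\omega(i,j)$. -/

import Mathlib

/-- The inclusion of the lattice `ℤ^d` into `ℝ^d`. -/
def latticePoint {d : ℕ} (a : Fin d → ℤ) : Fin d → ℝ := fun k => (a k : ℝ)

/-- The lifted points `(a, ω a)`, for `a ∈ ℤ^d`, in `ℝ^d × ℝ`. -/
def liftedPoints {d : ℕ} (ω : (Fin d → ℤ) → ℝ) : Set ((Fin d → ℝ) × ℝ) :=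
  Set.range fun a => (latticePoint a, ω a)

/-- The part of a set `C ⊆ ℝ^d × ℝ` on which the linear functional `(x, h) ↦ c x + h`, whose
coefficient at the last coordinate is positive, attains its minimum over `C`. -/
def lowerFaceAt {d : ℕ} (C : Set ((Fin d → ℝ) × ℝ)) (c : (Fin d → ℝ) →ₗ[ℝ] ℝ) :
    Set ((Fin d → ℝ) × ℝ) :=
  {p | p ∈ C ∧ ∀ q ∈ C, c p.1 + p.2 ≤ c q.1 + q.2}

/-- The regular subdivision of `ℤ^d` with height function `ω`: the collection of the images, under
the projection omitting the last coordinate, of all nonempty lower faces of the convex hull of the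
lifted points. Faces of every dimension are included. -/
def regularSubdivision {d : ℕ} (ω : (Fin d → ℤ) → ℝ) : Set (Set (Fin d → ℝ)) :=
  {S | ∃ c : (Fin d → ℝ) →ₗ[ℝ] ℝ,
    (lowerFaceAt (convexHull ℝ (liftedPoints ω)) c).Nonempty ∧
      S = Prod.fst '' lowerFaceAt (convexHull ℝ (liftedPoints ω)) c}

/-- The height function `ω` induces the collection of cells `T`. -/
def Induces {d : ℕ} (ω : (Fin d → ℤ) → ℝ) (T : Set (Set (Fin d → ℝ))) : Prop :=
  regularSubdivision ω = T

/-- The linear form `z_i - z_j` on `ℝ^d`, with coordinates `z_1, …, z_d` and `z_0 = 0`. The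
hyperplanes of the affine Coxeter arrangement of type `A_d` are the sets `z_i - z_j = ℓ`
with `0 ≤ i < j ≤ d` and `ℓ ∈ ℤ`. -/
def coxeterForm {d : ℕ} (i j : Fin (d + 1)) (z : Fin d → ℝ) : ℝ :=
  (Fin.cons 0 z : Fin (d + 1) → ℝ) i - (Fin.cons 0 z : Fin (d + 1) → ℝ) j

/-- The closed cell of the affine Coxeter arrangement that has `z` in its relative interior: the
intersection of all closed halfspaces bounded by hyperplanes of the arrangement that contain `z`. -/
def alcovedCell {d : ℕ} (z : Fin d → ℝ) : Set (Fin d → ℝ) :=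
  {w | ∀ i j : Fin (d + 1), i < j → ∀ l : ℤ,
    (coxeterForm i j z ≤ l → coxeterForm i j w ≤ l) ∧
      ((l : ℝ) ≤ coxeterForm i j z → (l : ℝ) ≤ coxeterForm i j w)}

/-- The alcoved triangulation of `ℝ^d`: all closed cells, of every dimension, of the affine Coxeter
arrangement. -/
def alcovedTriangulation (d : ℕ) : Set (Set (Fin d → ℝ)) :=
  Set.range alcovedCell

/-- The unimodular transformation `τ (z_1, z_2) = (z_1 - z_2, z_2)` of the plane. -/
def tau : (Fin 2 → ℝ) →ₗ[ℝ] (Fin 2 → ℝ) :=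
  Matrix.toLin' !![1, -1; 0, 1]

/-- The honeycomb triangulation of the whole plane: the image of the alcoved triangulation of the
plane under `τ`. -/
def honeycombTriangulation : Set (Set (Fin 2 → ℝ)) :=
  {S | ∃ C ∈ alcovedTriangulation 2, S = tau '' C}

/-! A cell of the regular subdivision is the convex hull of the lattice points minimizing `ω + c`
for some linear `c`, and a honeycomb cell is the convex hull of a nonempty set of vertices of a unit
lattice triangle. So the theorem compares argmin sets with sets of triangle vertices.

If the honeycomb is induced, each edge is exactly an argmin set. The two vertices opposite the edge
have the same sum as its endpoints and at least one is not a minimizer, which gives the strict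
inequality (`lt_of_edge_mem_regularSubdivision`).

Conversely, subtract from `ω` its affine interpolation on a triangle. The inequalities make
directional differences monotone, so the remainder decreases strictly along a lattice path to the
triangle and is positive off it (`pos_of_honeycomb_convex`); every triangle is thus an argmin set.
Intersecting with neighbouring triangles yields the smaller faces. There are no other cells: the
barycenter of finitely many minimizers lies in some triangle, and comparing the two supporting
functionals there forces the minimizers to be vertices of it (`exists_triangle_of_finset`). -/

/-! ### Cells as convex hulls of argmin sets -/

/-- The lattice points minimizing the height function `ω` tilted by the linear functional `c`. -/
def tiltedArgmin {d : ℕ} (ω : (Fin d → ℤ) → ℝ) (c : (Fin d → ℝ) →ₗ[ℝ] ℝ) : Set (Fin d → ℤ) :=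
  {a | ∀ b, c (latticePoint a) + ω a ≤ c (latticePoint b) + ω b}

/-- A lower face of a convex hull is the convex hull of the generators it contains. -/
theorem lowerFaceAt_convexHull {d : ℕ} (P : Set ((Fin d → ℝ) × ℝ)) (c : (Fin d → ℝ) →ₗ[ℝ] ℝ) :
    lowerFaceAt (convexHull ℝ P) c = convexHull ℝ (lowerFaceAt P c) := by
  apply Set.Subset.antisymm
  · rintro p ⟨hp, hmin⟩
    -- The set on the right is convex: a proper convex combination attains the minimum only if both
    -- endpoints do.
    have hsub : convexHull ℝ P ⊆ {q | c p.1 + p.2 ≤ c q.1 + q.2 ∧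
        (c q.1 + q.2 = c p.1 + p.2 → q ∈ convexHull ℝ (lowerFaceAt P c))} := by
      apply convexHull_min
      · intro q hq
        refine ⟨hmin q (subset_convexHull ℝ P hq), fun h => subset_convexHull ℝ _ ⟨hq, ?_⟩⟩
        intro r hr
        rw [h]
        exact hmin r (subset_convexHull ℝ P hr)
      · rw [convex_iff_forall_pos]
        rintro x ⟨hx, hx'⟩ y ⟨hy, hy'⟩ s t hs ht hst
        have e : c (s • x + t • y).1 + (s • x + t • y).2 - (c p.1 + p.2) =
            s * (c x.1 + x.2 - (c p.1 + p.2)) + t * (c y.1 + y.2 - (c p.1 + p.2)) := by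
          obtain rfl : s = 1 - t := by linarith
          simp only [Prod.fst_add, Prod.smul_fst, map_add, map_smul, smul_eq_mul, Prod.snd_add,
            Prod.smul_snd]
          ring
        have h1 := mul_nonneg hs.le (sub_nonneg.2 hx)
        have h2 := mul_nonneg ht.le (sub_nonneg.2 hy)
        refine ⟨by linarith, fun h => ?_⟩
        have h1' : s * (c x.1 + x.2 - (c p.1 + p.2)) = 0 := by linarith
        have h2' : t * (c y.1 + y.2 - (c p.1 + p.2)) = 0 := by linarith
        have hx0 := (mul_eq_zero.1 h1').resolve_left hs.ne'
        have hy0 := (mul_eq_zero.1 h2').resolve_left ht.ne'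
        exact convex_convexHull ℝ _ (hx' (by linarith)) (hy' (by linarith)) hs.le ht.le hst
    exact (hsub hp).2 rfl
  · apply convexHull_min
    · rintro p ⟨hp, hmin⟩
      refine ⟨subset_convexHull ℝ P hp, fun q hq => ?_⟩
      have hconv : Convex ℝ {q : (Fin d → ℝ) × ℝ | c p.1 + p.2 ≤ c q.1 + q.2} :=
        convex_halfSpace_ge
          (c.comp (LinearMap.fst ℝ _ _) + LinearMap.snd ℝ (Fin d → ℝ) ℝ).isLinear _
      exact convexHull_min hmin hconv hq
    · rintro x ⟨hx, hx'⟩ y ⟨hy, hy'⟩ s t hs ht hst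
      refine ⟨convex_convexHull ℝ P hx hy hs ht hst, fun q hq => ?_⟩
      have h1 := mul_le_mul_of_nonneg_left (hx' q hq) hs
      have h2 := mul_le_mul_of_nonneg_left (hy' q hq) ht
      obtain rfl : s = 1 - t := by linarith
      simp only [Prod.fst_add, Prod.smul_fst, map_add, map_smul, smul_eq_mul, Prod.snd_add,
        Prod.smul_snd]
      linarith

theorem fst_image_lowerFaceAt_liftedPoints {d : ℕ} (ω : (Fin d → ℤ) → ℝ)
    (c : (Fin d → ℝ) →ₗ[ℝ] ℝ) :
    Prod.fst '' lowerFaceAt (convexHull ℝ (liftedPoints ω)) c =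
      convexHull ℝ (latticePoint '' tiltedArgmin ω c) := by
  have h := (LinearMap.fst ℝ (Fin d → ℝ) ℝ).image_convexHull (lowerFaceAt (liftedPoints ω) c)
  rw [lowerFaceAt_convexHull]
  refine h.trans (congrArg _ ?_)
  ext x
  constructor
  · rintro ⟨_, ⟨⟨a, rfl⟩, hmin⟩, rfl⟩
    exact ⟨a, fun b => hmin _ ⟨b, rfl⟩, rfl⟩
  · rintro ⟨a, ha, rfl⟩
    refine ⟨(latticePoint a, ω a), ⟨⟨a, rfl⟩, ?_⟩, rfl⟩
    rintro _ ⟨b, rfl⟩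
    exact ha b

/-- The cells of a regular subdivision are the convex hulls of the nonempty sets of minimizers of
tilted heights. -/
theorem mem_regularSubdivision_iff {d : ℕ} (ω : (Fin d → ℤ) → ℝ) (S : Set (Fin d → ℝ)) :
    S ∈ regularSubdivision ω ↔ ∃ c, (tiltedArgmin ω c).Nonempty ∧
      S = convexHull ℝ (latticePoint '' tiltedArgmin ω c) := by
  simp only [regularSubdivision, Set.mem_ofPred_eq]
  refine exists_congr fun c => ?_
  rw [← fst_image_lowerFaceAt_liftedPoints, ← Set.image_nonempty (f := Prod.fst),
    fst_image_lowerFaceAt_liftedPoints, convexHull_nonempty_iff, Set.image_nonempty]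

/-- At a common minimizer the averaged height equals the average of the two minima, so any point
attaining it attains both. -/
theorem tiltedArgmin_inter {d : ℕ} (ω : (Fin d → ℤ) → ℝ) (c c' : (Fin d → ℝ) →ₗ[ℝ] ℝ)
    (h : (tiltedArgmin ω c ∩ tiltedArgmin ω c').Nonempty) :
    tiltedArgmin ω ((1 / 2 : ℝ) • c + (1 / 2 : ℝ) • c') =
      tiltedArgmin ω c ∩ tiltedArgmin ω c' := by
  obtain ⟨u, hu, hu'⟩ := h
  ext a
  simp only [tiltedArgmin, Set.mem_ofPred_eq, Set.mem_inter_iff, LinearMap.add_apply,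
    LinearMap.smul_apply, smul_eq_mul] at *
  constructor
  · intro ha
    have h1 := hu a
    have h2 := hu' a
    have h3 := ha u
    exact ⟨fun b => by linarith [hu b], fun b => by linarith [hu' b]⟩
  · rintro ⟨ha, ha'⟩ b
    linarith [ha b, ha' b]

/-! ### Lattice triangles and barycentric coordinates -/

/-- The vertices of the lattice triangle with corner `a` and legs `ε e₁`, `ε e₂`. -/
def triangleVertex (a : Fin 2 → ℤ) (ε : ℤ) : Fin 3 → Fin 2 → ℤ :=
  ![a, ![a 0 + ε, a 1], ![a 0, a 1 + ε]]

/-- The barycentric coordinates with respect to `triangleVertex a ε`, for `ε = 1` or `ε = -1`. -/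
def triangleCoord (a : Fin 2 → ℤ) (ε : ℤ) (p : Fin 2 → ℝ) : Fin 3 → ℝ :=
  ![1 - ε * (p 0 - a 0) - ε * (p 1 - a 1), ε * (p 0 - a 0), ε * (p 1 - a 1)]

theorem sum_triangleCoord (a : Fin 2 → ℤ) (ε : ℤ) (p : Fin 2 → ℝ) :
    ∑ k, triangleCoord a ε p k = 1 := by
  simp [Fin.sum_univ_three, triangleCoord]
  ring

theorem sum_triangleCoord_smul (a : Fin 2 → ℤ) {ε : ℤ} (hε : ε = 1 ∨ ε = -1) (p : Fin 2 → ℝ) :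
    ∑ k, triangleCoord a ε p k • latticePoint (triangleVertex a ε k) = p := by
  ext i
  rcases hε with rfl | rfl <;> fin_cases i <;>
    simp [Fin.sum_univ_three, triangleCoord, triangleVertex, latticePoint] <;> ring

theorem triangleCoord_triangleVertex (a : Fin 2 → ℤ) {ε : ℤ} (hε : ε = 1 ∨ ε = -1) (k l : Fin 3) :
    triangleCoord a ε (latticePoint (triangleVertex a ε k)) l = if k = l then 1 else 0 := by
  rcases hε with rfl | rfl <;> fin_cases k <;> fin_cases l <;>
    simp [triangleCoord, triangleVertex, latticePoint]

theorem triangleCoord_combo (a : Fin 2 → ℤ) (ε : ℤ) (p q : Fin 2 → ℝ) {s t : ℝ} (hst : s + t = 1)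
    (k : Fin 3) : triangleCoord a ε (s • p + t • q) k =
      s * triangleCoord a ε p k + t * triangleCoord a ε q k := by
  obtain rfl : s = 1 - t := by linarith
  fin_cases k <;> simp [triangleCoord] <;> ring

theorem mem_convexHull_triangle_iff (a : Fin 2 → ℤ) {ε : ℤ} (hε : ε = 1 ∨ ε = -1)
    (I : Set (Fin 3)) (q : Fin 2 → ℝ) :
    q ∈ convexHull ℝ (latticePoint '' (triangleVertex a ε '' I)) ↔
      ∀ k, 0 ≤ triangleCoord a ε q k ∧ (k ∉ I → triangleCoord a ε q k = 0) := by
  classical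
  constructor
  · intro hq
    refine convexHull_min (t := {q | ∀ k, 0 ≤ triangleCoord a ε q k ∧
      (k ∉ I → triangleCoord a ε q k = 0)}) ?_ ?_ hq
    · rintro _ ⟨_, ⟨l, hl, rfl⟩, rfl⟩ k
      rw [triangleCoord_triangleVertex a hε]
      by_cases h : l = k
      · subst h
        simp [hl]
      · simp [h]
    · intro x hx y hy s t hs ht hst k
      rw [triangleCoord_combo a ε x y hst]
      refine ⟨add_nonneg (mul_nonneg hs (hx k).1) (mul_nonneg ht (hy k).1), fun hk => ?_⟩
      rw [(hx k).2 hk, (hy k).2 hk]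
      simp
  · intro h
    have hzero : ∀ k ∈ Finset.univ, k ∉ Finset.univ.filter (· ∈ I) →
        triangleCoord a ε q k = 0 := fun k _ hk => (h k).2 (by simpa using hk)
    rw [← sum_triangleCoord_smul a hε q, ← Finset.sum_subset (Finset.filter_subset (· ∈ I) _)
      (fun k hk hk' => by rw [hzero k hk hk', zero_smul])]
    refine (convex_convexHull ℝ _).sum_mem (fun k _ => (h k).1) ?_ fun k hk =>
      subset_convexHull ℝ _ ⟨_, ⟨k, (Finset.mem_filter.1 hk).2, rfl⟩, rfl⟩
    rw [Finset.sum_subset (Finset.filter_subset (· ∈ I) _) hzero, sum_triangleCoord]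

/-- Every point of the plane lies in one of the lattice triangles. -/
theorem exists_triangleCoord_nonneg (p : Fin 2 → ℝ) :
    ∃ (a : Fin 2 → ℤ) (ε : ℤ), (ε = 1 ∨ ε = -1) ∧ ∀ k, 0 ≤ triangleCoord a ε p k := by
  have h0 := Int.floor_le (p 0)
  have h0' := Int.lt_floor_add_one (p 0)
  have h1 := Int.floor_le (p 1)
  have h1' := Int.lt_floor_add_one (p 1)
  by_cases h : (p 0 - ⌊p 0⌋) + (p 1 - ⌊p 1⌋) ≤ 1
  · refine ⟨![⌊p 0⌋, ⌊p 1⌋], 1, Or.inl rfl, fun k => ?_⟩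
    fin_cases k <;> simp [triangleCoord, -Int.self_sub_floor] <;> linarith
  · refine ⟨![⌊p 0⌋ + 1, ⌊p 1⌋ + 1], -1, Or.inr rfl, fun k => ?_⟩
    fin_cases k <;> simp [triangleCoord, -Int.self_sub_floor] <;> linarith

/-! ### Honeycomb cells as faces of lattice triangles -/

/-- Under `tau` the forms `z₁ - z₂`, `z₂`, `z₁` become `x`, `y`, `x + y`. Since `z₀ = 0`, the last
two enter `coxeterForm` negated, hence the use of `-l`. -/
theorem mem_tau_image_alcovedCell_iff (z q : Fin 2 → ℝ) :
    q ∈ tau '' alcovedCell z ↔ ∀ l : ℤ,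
      ((tau z 0 ≤ l → q 0 ≤ l) ∧ (l ≤ tau z 0 → l ≤ q 0)) ∧
      ((tau z 1 ≤ l → q 1 ≤ l) ∧ (l ≤ tau z 1 → l ≤ q 1)) ∧
      ((tau z 0 + tau z 1 ≤ l → q 0 + q 1 ≤ l) ∧ (l ≤ tau z 0 + tau z 1 → l ≤ q 0 + q 1)) := by
  have t0 : ∀ w, tau w 0 = w 0 - w 1 := fun w => by
    simp [tau, Matrix.toLin'_apply, Matrix.mulVec, dotProduct, Fin.sum_univ_two]; ring
  have t1 : ∀ w, tau w 1 = w 1 := fun w => by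
    simp [tau, Matrix.toLin'_apply, Matrix.mulVec, dotProduct, Fin.sum_univ_two]
  have c01 : ∀ w : Fin 2 → ℝ, coxeterForm 0 1 w = -w 0 := fun w => by
    simp [coxeterForm, Fin.cons]; rfl
  have c02 : ∀ w : Fin 2 → ℝ, coxeterForm 0 2 w = -w 1 := fun w => by
    simp [coxeterForm, Fin.cons]; rfl
  have c12 : ∀ w : Fin 2 → ℝ, coxeterForm 1 2 w = w 0 - w 1 := fun w => by
    simp [coxeterForm, Fin.cons]; rfl
  constructor
  · rintro ⟨w, hw, rfl⟩ l
    have h01 := hw 0 1 (by decide) (-l)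
    have h02 := hw 0 2 (by decide) (-l)
    have h12 := hw 1 2 (by decide) l
    rw [c01, c01] at h01
    rw [c02, c02] at h02
    rw [c12, c12] at h12
    push_cast at h01 h02
    rw [neg_le_neg_iff, neg_le_neg_iff, neg_le_neg_iff, neg_le_neg_iff] at h01 h02
    simp only [t0, t1, sub_add_cancel]
    exact ⟨h12, h02.symm, h01.symm⟩
  · intro h
    refine ⟨![q 0 + q 1, q 1], ?_, ?_⟩
    · intro i j hij l
      obtain ⟨h0, -, -⟩ := h l
      obtain ⟨-, h1, h2⟩ := h (-l)
      simp only [t0, t1, sub_add_cancel] at h0 h1 h2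
      push_cast at h1 h2
      fin_cases i <;> fin_cases j <;> simp at hij
      · simp only [Fin.zero_eta, Fin.mk_one, c01]
        exact ⟨fun hl => by have := h2.2 (by linarith); simp; linarith,
          fun hl => by have := h2.1 (by linarith); simp; linarith⟩
      · simp only [Fin.zero_eta, Fin.reduceFinMk, c02]
        exact ⟨fun hl => by have := h1.2 (by linarith); simp; linarith,
          fun hl => by have := h1.1 (by linarith); simp; linarith⟩
      · simp only [Fin.mk_one, Fin.reduceFinMk, c12]
        simpa using h0
    · ext i
      fin_cases i <;> simp [t0, t1]

/-- No integer lies strictly inside `[n, n + 1]`, so only its endpoints can tell `x` and `y` apart.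
-/
theorem int_bounds_of_unit_interval {n l : ℤ} {x y u v : ℝ} (hx : x = n + u) (hy : y = n + v)
    (hu : 0 ≤ u) (hv : 0 ≤ v) (hu1 : u ≤ 1) (hv1 : v ≤ 1) (h0 : u = 0 → v = 0)
    (h1 : u = 1 → v = 1) : (x ≤ l → y ≤ l) ∧ (l ≤ x → l ≤ y) := by
  subst hx hy
  constructor
  · intro h
    rcases lt_trichotomy n l with hl | rfl | hl
    · have : (n : ℝ) + 1 ≤ l := by exact_mod_cast hl
      linarith
    · linarith [h0 (by linarith)]
    · have : (l : ℝ) + 1 ≤ n := by exact_mod_cast hl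
      linarith
  · intro h
    rcases lt_trichotomy (n + 1) l with hl | rfl | hl
    · have : (n : ℝ) + 1 < l := by exact_mod_cast hl
      linarith
    · push_cast at h ⊢
      linarith [h1 (by linarith)]
    · have : (l : ℝ) ≤ n := by exact_mod_cast Int.lt_add_one_iff.1 hl
      linarith

/-- The zero lines of the barycentric coordinates belong to the arrangement, so the cell of a point
of the triangle is the face on which the coordinates vanishing at that point vanish. -/
theorem tau_image_alcovedCell (a : Fin 2 → ℤ) {ε : ℤ} (hε : ε = 1 ∨ ε = -1) (z : Fin 2 → ℝ)
    (hz : ∀ k, 0 ≤ triangleCoord a ε (tau z) k) :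
    tau '' alcovedCell z = convexHull ℝ
      (latticePoint '' (triangleVertex a ε '' {k | triangleCoord a ε (tau z) k ≠ 0})) := by
  ext q
  rw [mem_convexHull_triangle_iff a hε, mem_tau_image_alcovedCell_iff]
  generalize tau z = p at *
  simp only [Set.mem_ofPred_eq, not_not, Fin.forall_fin_succ, Fin.isValue, triangleCoord,
    IsEmpty.forall_iff, and_true] at hz ⊢
  simp at hz ⊢
  rcases hε with rfl | rfl
  · simp at hz ⊢
    obtain ⟨hz0, hz1, hz2⟩ := hz
    constructor
    · intro h
      -- These three integers give the lines bounding the triangle.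
      obtain ⟨⟨h1, h2⟩, -, -⟩ := h (a 0)
      obtain ⟨-, ⟨h3, h4⟩, -⟩ := h (a 1)
      obtain ⟨-, -, h5, h6⟩ := h (a 0 + a 1 + 1)
      push_cast at h5 h6
      exact ⟨⟨by linarith [h5 (by linarith)], fun e => by
          linarith [h5 (by linarith), h6 (by linarith)]⟩,
        ⟨h2 hz1, fun e => by linarith [h1 (by linarith), h2 (by linarith)]⟩,
        ⟨h4 hz2, fun e => by linarith [h3 (by linarith), h4 (by linarith)]⟩⟩
    · rintro ⟨⟨h1, h2⟩, ⟨h3, h4⟩, h5, h6⟩ l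
      -- On the triangle each of `x`, `y`, `x + y` ranges over a unit interval, and an endpoint
      -- value means that one or two barycentric coordinates vanish.
      refine ⟨int_bounds_of_unit_interval (n := a 0) (u := p 0 - a 0) (v := q 0 - a 0)
          (by ring) (by ring) ?_ ?_ ?_ ?_ ?_ ?_,
        int_bounds_of_unit_interval (n := a 1) (u := p 1 - a 1) (v := q 1 - a 1)
          (by ring) (by ring) ?_ ?_ ?_ ?_ ?_ ?_,
        int_bounds_of_unit_interval (n := a 0 + a 1) (u := p 0 + p 1 - a 0 - a 1)
          (v := q 0 + q 1 - a 0 - a 1)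
          (by push_cast; ring) (by push_cast; ring) ?_ ?_ ?_ ?_ ?_ ?_⟩ <;>
      first
      | linarith
      | (intro e; linarith [h4 (by linarith)])
      | (intro e; linarith [h6 (by linarith)])
      | (intro e; linarith [h2 (by linarith)])
      | (intro e; linarith [h4 (by linarith), h6 (by linarith)])
      | (intro e; linarith [h4 (by linarith), h2 (by linarith)])
      | (intro e; linarith [h6 (by linarith), h2 (by linarith)])
  · simp at hz ⊢
    obtain ⟨hz0, hz1, hz2⟩ := hz
    constructor
    · intro h
      obtain ⟨⟨h1, h2⟩, -, -⟩ := h (a 0)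
      obtain ⟨-, ⟨h3, h4⟩, -⟩ := h (a 1)
      obtain ⟨-, -, h5, h6⟩ := h (a 0 + a 1 - 1)
      push_cast at h5 h6
      exact ⟨⟨by linarith [h6 (by linarith)], fun e => by
          linarith [h5 (by linarith), h6 (by linarith)]⟩,
        ⟨h1 hz1, fun e => by linarith [h1 (by linarith), h2 (by linarith)]⟩,
        ⟨h3 hz2, fun e => by linarith [h3 (by linarith), h4 (by linarith)]⟩⟩
    · rintro ⟨⟨h1, h2⟩, ⟨h3, h4⟩, h5, h6⟩ l
      refine ⟨int_bounds_of_unit_interval (n := a 0 - 1) (u := p 0 - a 0 + 1) (v := q 0 - a 0 + 1)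
          (by push_cast; ring) (by push_cast; ring) ?_ ?_ ?_ ?_ ?_ ?_,
        int_bounds_of_unit_interval (n := a 1 - 1) (u := p 1 - a 1 + 1) (v := q 1 - a 1 + 1)
          (by push_cast; ring) (by push_cast; ring) ?_ ?_ ?_ ?_ ?_ ?_,
        int_bounds_of_unit_interval (n := a 0 + a 1 - 1) (u := p 0 + p 1 - a 0 - a 1 + 1)
          (v := q 0 + q 1 - a 0 - a 1 + 1)
          (by push_cast; ring) (by push_cast; ring) ?_ ?_ ?_ ?_ ?_ ?_⟩ <;>
      first
      | linarith
      | (intro e; linarith [h4 (by linarith)])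
      | (intro e; linarith [h6 (by linarith)])
      | (intro e; linarith [h2 (by linarith)])
      | (intro e; linarith [h4 (by linarith), h6 (by linarith)])
      | (intro e; linarith [h4 (by linarith), h2 (by linarith)])
      | (intro e; linarith [h6 (by linarith), h2 (by linarith)])

/-- The honeycomb triangulation consists of the nonempty faces of the lattice triangles. -/
theorem mem_honeycombTriangulation_iff (S : Set (Fin 2 → ℝ)) :
    S ∈ honeycombTriangulation ↔ ∃ (a : Fin 2 → ℤ) (ε : ℤ) (I : Set (Fin 3)),
      (ε = 1 ∨ ε = -1) ∧ I.Nonempty ∧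
        S = convexHull ℝ (latticePoint '' (triangleVertex a ε '' I)) := by
  classical
  constructor
  · rintro ⟨_, ⟨z, rfl⟩, rfl⟩
    obtain ⟨a, ε, hε, hz⟩ := exists_triangleCoord_nonneg (tau z)
    refine ⟨a, ε, _, hε, ?_, tau_image_alcovedCell a hε z hz⟩
    by_contra hne
    rw [Set.not_nonempty_iff_eq_empty, Set.eq_empty_iff_forall_notMem] at hne
    have h1 := sum_triangleCoord a ε (tau z)
    rw [Finset.sum_eq_zero fun k _ => by simpa using hne k] at h1
    exact zero_ne_one h1
  · rintro ⟨a, ε, I, hε, ⟨i, hi⟩, rfl⟩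
    set F : Finset (Fin 3) := Finset.univ.filter (· ∈ I) with hF
    have hiF : i ∈ F := by simp [hF, hi]
    have hcard : (0 : ℝ) < F.card := by exact_mod_cast Finset.card_pos.2 ⟨i, hiF⟩
    -- Uniform weights on `I`: the barycenter lies in the relative interior of the face.
    set w : Fin 3 → ℝ := fun k => if k ∈ I then (F.card : ℝ)⁻¹ else 0 with hw
    have hsum : ∑ k, w k = 1 := by
      simp only [hw, ← Finset.sum_filter, Finset.sum_const, nsmul_eq_mul]
      exact mul_inv_cancel₀ hcard.ne'
    set p : Fin 2 → ℝ := ![a 0 + ε * w 1, a 1 + ε * w 2] with hp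
    obtain ⟨z, hz⟩ : ∃ z, tau z = p := by
      refine ⟨![p 0 + p 1, p 1], ?_⟩
      ext j
      fin_cases j <;>
        simp [tau, Matrix.toLin'_apply, Matrix.mulVec, dotProduct, Fin.sum_univ_two]
    have hcoord : triangleCoord a ε p = w := by
      rw [Fin.sum_univ_three] at hsum
      ext k
      rcases hε with rfl | rfl <;> fin_cases k <;> simp [triangleCoord, hp] <;> linarith
    refine ⟨_, ⟨z, rfl⟩, ?_⟩
    rw [tau_image_alcovedCell a hε z, hz, hcoord]
    · congr 3
      ext k
      by_cases hk : k ∈ I <;> simp [hw, hk, hcard.ne']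
    · intro k
      rw [hz, hcoord]
      by_cases hk : k ∈ I <;> simp [hw, hk]

/-! ### From cells to inequalities -/

/-- A lattice point has integer barycentric coordinates; being nonnegative with sum 1, they are
those of a vertex. -/
theorem mem_of_latticePoint_mem_convexHull (a : Fin 2 → ℤ) {ε : ℤ} (hε : ε = 1 ∨ ε = -1)
    (I : Set (Fin 3)) {b : Fin 2 → ℤ}
    (hb : latticePoint b ∈ convexHull ℝ (latticePoint '' (triangleVertex a ε '' I))) :
    b ∈ triangleVertex a ε '' I := by
  rw [mem_convexHull_triangle_iff a hε] at hb
  set x := ε * (b 0 - a 0) with hx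
  set y := ε * (b 1 - a 1) with hy
  have e : triangleCoord a ε (latticePoint b) = ![((1 - x - y : ℤ) : ℝ), (x : ℝ), (y : ℝ)] := by
    simp [triangleCoord, latticePoint, hx, hy]
  have key : ∀ k, b = triangleVertex a ε k → b ∈ triangleVertex a ε '' I := by
    rintro k rfl
    refine ⟨k, ?_, rfl⟩
    by_contra hk
    have := (hb k).2 hk
    rw [triangleCoord_triangleVertex a hε] at this
    simp at this
  have h0 : 0 ≤ 1 - x - y := by
    have := (hb 0).1
    rw [e] at this
    exact Int.cast_nonneg_iff.1 this
  have h1 : 0 ≤ x := by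
    have := (hb 1).1
    rw [e] at this
    exact Int.cast_nonneg_iff.1 this
  have h2 : 0 ≤ y := by
    have := (hb 2).1
    rw [e] at this
    exact Int.cast_nonneg_iff.1 this
  have hcases : (x = 0 ∧ y = 0) ∨ (x = 1 ∧ y = 0) ∨ (x = 0 ∧ y = 1) := by omega
  rcases hcases with h | h | h
  · apply key 0
    ext j
    rcases hε with rfl | rfl <;> fin_cases j <;> simp [triangleVertex] <;> omega
  · apply key 1
    ext j
    rcases hε with rfl | rfl <;> fin_cases j <;> simp [triangleVertex] <;> omega
  · apply key 2
    ext j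
    rcases hε with rfl | rfl <;> fin_cases j <;> simp [triangleVertex] <;> omega

/-- A face of a lattice triangle determines the lattice points spanning it. -/
theorem eq_of_convexHull_eq (a : Fin 2 → ℤ) {ε : ℤ} (hε : ε = 1 ∨ ε = -1)
    (I : Set (Fin 3)) (M : Set (Fin 2 → ℤ))
    (h : convexHull ℝ (latticePoint '' (triangleVertex a ε '' I)) =
      convexHull ℝ (latticePoint '' M)) : M = triangleVertex a ε '' I := by
  have hsub : M ⊆ triangleVertex a ε '' I := fun b hb =>
    mem_of_latticePoint_mem_convexHull a hε I (h ▸ subset_convexHull ℝ _ ⟨b, hb, rfl⟩)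
  obtain ⟨J, -, rfl⟩ := Set.subset_image_iff.1 hsub
  refine hsub.antisymm ?_
  rintro b hb
  exact mem_of_latticePoint_mem_convexHull a hε J (h ▸ subset_convexHull ℝ _ ⟨b, hb, rfl⟩)

theorem latticePoint_add {d : ℕ} (a b : Fin d → ℤ) :
    latticePoint (a + b) = latticePoint a + latticePoint b := by
  ext k
  simp [latticePoint]

/-- If an edge of a lattice triangle is a cell of the regular subdivision, then `ω` is strictly
convex across that edge. -/
theorem lt_of_edge_mem_regularSubdivision {ω : (Fin 2 → ℤ) → ℝ} {a : Fin 2 → ℤ} {k l : Fin 3}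
    (hS : convexHull ℝ (latticePoint '' (triangleVertex a 1 '' {k, l})) ∈ regularSubdivision ω)
    {x y : Fin 2 → ℤ} (hx : x ∉ triangleVertex a 1 '' {k, l})
    (hxy : x + y = triangleVertex a 1 k + triangleVertex a 1 l) :
    ω (triangleVertex a 1 k) + ω (triangleVertex a 1 l) < ω x + ω y := by
  obtain ⟨c, -, hc⟩ := (mem_regularSubdivision_iff _ _).1 hS
  have hM := eq_of_convexHull_eq a (Or.inl rfl) _ _ hc
  have hk : triangleVertex a 1 k ∈ tiltedArgmin ω c := hM ▸ ⟨k, by simp, rfl⟩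
  have hl : triangleVertex a 1 l ∈ tiltedArgmin ω c := hM ▸ ⟨l, by simp, rfl⟩
  rw [← hM] at hx
  simp only [tiltedArgmin, Set.mem_ofPred_eq, not_forall, not_le] at hx hk hl
  obtain ⟨b, hb⟩ := hx
  -- Strictness comes from `x` alone; for `y` the weak inequality suffices.
  have h1 := hk b
  have h2 := hl y
  have h3 := congrArg (fun v => c (latticePoint v)) hxy
  simp only [latticePoint_add, map_add] at h3
  linarith

/-! ### From local to global convexity -/

/-- A function on `ℤ²` that is locally strictly convex with respect to the honeycomb triangulation
and vanishes on the standard triangle is positive at all other lattice points. -/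
theorem pos_of_honeycomb_convex (g : ℤ → ℤ → ℝ)
    (h1 : ∀ i j, g (i - 1) j + g i (j - 1) < g (i - 1) (j - 1) + g i j)
    (h2 : ∀ i j, g i (j - 1) + g i j < g (i - 1) j + g (i + 1) (j - 1))
    (h3 : ∀ i j, g (i - 1) j + g i j < g i (j - 1) + g (i - 1) (j + 1))
    (g00 : g 0 0 = 0) (g10 : g 1 0 = 0) (g01 : g 0 1 = 0) (x y : ℤ) :
    0 ≤ g x y ∧ (¬(x = 0 ∧ y = 0) → ¬(x = 1 ∧ y = 0) → ¬(x = 0 ∧ y = 1) → 0 < g x y) := by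
  have m1 : ∀ i, StrictMono fun j => g (i + 1) j - g i j := fun i =>
    strictMono_int_of_lt_succ fun j => by
      have := h1 (i + 1) (j + 1)
      simp only [add_sub_cancel_right] at this
      linarith
  have m2 : ∀ n, StrictMono fun i => g (i + 1) (n - i) - g i (n - i) := fun n =>
    strictMono_int_of_lt_succ fun i => by
      have := h2 (i + 1) (n - i)
      simp only [add_sub_cancel_right] at this
      rw [show n - i - 1 = n - (i + 1) by ring] at this
      linarith
  have m3 : ∀ j, StrictMono fun i => g (i + 1) (j - 1) - g i j := fun j =>
    strictMono_int_of_lt_succ fun i => by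
      have := h2 (i + 1) j
      simp only [add_sub_cancel_right] at this
      linarith
  have m4 : ∀ i, StrictAnti fun j => g (i + 1) (j - 1) - g i j := fun i =>
    strictAnti_int_of_succ_lt fun j => by
      have := h3 (i + 1) j
      simp only [add_sub_cancel_right] at this ⊢
      linarith
  -- The horizontal difference is 0 at the origin; it grows or shrinks along `(0, 0)`, `(0, i + j)`,
  -- `(i, j)`. For `d3` and `d3'` the difference along `(1, -1)` is 0 at `(0, 1)`, and the path is
  -- `(0, 1)`, `(0, j)`, `(i, j)`.
  have d1 : ∀ i j, 0 ≤ i → 0 ≤ i + j → ¬(i = 0 ∧ j = 0) → g i j < g (i + 1) j := by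
    intro i j hi hj hne
    have p := (m1 0).monotone hj
    have q := (m2 (i + j)).monotone hi
    simp only [add_sub_cancel_left, sub_zero, zero_add] at p q
    rcases hi.lt_or_eq with hi' | rfl
    · have q := m2 (i + j) hi'
      simp only [add_sub_cancel_left, sub_zero, zero_add] at q
      linarith
    · have p := m1 0 (show 0 < 0 + j by omega)
      simp only [zero_add] at p ⊢
      linarith
  have d1' : ∀ i j, i ≤ 0 → i + j ≤ 0 → ¬(i = 0 ∧ j = 0) → g (i + 1) j < g i j := by
    intro i j hi hj hne
    have p := (m1 0).monotone hj
    have q := (m2 (i + j)).monotone hi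
    simp only [add_sub_cancel_left, sub_zero, zero_add] at p q
    rcases hi.lt_or_eq with hi' | rfl
    · have q := m2 (i + j) hi'
      simp only [add_sub_cancel_left, sub_zero, zero_add] at q
      linarith
    · have p := m1 0 (show 0 + j < 0 by omega)
      simp only [zero_add] at p ⊢
      linarith
  have d3 : ∀ i j, 0 ≤ i → j ≤ 1 → ¬(i = 0 ∧ j = 1) → g i j < g (i + 1) (j - 1) := by
    intro i j hi hj hne
    have p := (m4 0).antitone hj
    have q := (m3 j).monotone hi
    simp only [sub_self, zero_add] at p q
    rcases hi.lt_or_eq with hi' | rfl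
    · have q := m3 j hi'
      simp only [zero_add] at q
      linarith
    · have p := m4 0 (show j < 1 by omega)
      simp only [sub_self, zero_add] at p ⊢
      linarith
  have d3' : ∀ i j, i ≤ 0 → 1 ≤ j → ¬(i = 0 ∧ j = 1) → g (i + 1) (j - 1) < g i j := by
    intro i j hi hj hne
    have p := (m4 0).antitone hj
    have q := (m3 j).monotone hi
    simp only [sub_self, zero_add] at p q
    rcases hi.lt_or_eq with hi' | rfl
    · have q := m3 j hi'
      simp only [zero_add] at q
      linarith
    · have p := m4 0 (show 1 < j by omega)
      simp only [sub_self, zero_add] at p ⊢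
      linarith
  -- Descent to the triangle. The odd shifts center the measure between 0 and 1, so a step between
  -- these two values of `x` or `x + y` costs nothing and another term still drops.
  have main : ∀ n : ℕ, ∀ x y : ℤ,
      (2 * x - 1).natAbs + (2 * (x + y) - 1).natAbs + y.natAbs = n →
      0 ≤ g x y ∧ (¬(x = 0 ∧ y = 0) → ¬(x = 1 ∧ y = 0) → ¬(x = 0 ∧ y = 1) → 0 < g x y) := by
    intro n
    induction n using Nat.strong_induction_on with
    | _ n ih =>
      intro x y hn
      by_cases e0 : x = 0 ∧ y = 0
      · simp [e0.1, e0.2, g00]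
      by_cases e1 : x = 1 ∧ y = 0
      · simp [e1.1, e1.2, g10]
      by_cases e2 : x = 0 ∧ y = 1
      · simp [e2.1, e2.2, g01]
      suffices h : 0 < g x y from ⟨h.le, fun _ _ _ => h⟩
      rcases le_or_gt x 0 with hx | hx
      · rcases le_or_gt (x + y) 0 with hs | hs
        · exact (ih _ (by omega) (x + 1) y rfl).1.trans_lt (d1' x y hx hs e0)
        · exact (ih _ (by omega) (x + 1) (y - 1) rfl).1.trans_lt
            (d3' x y hx (by omega) e2)
      · rcases le_or_gt (x + y) 0 with hs | hs
        · have := d3 (x - 1) (y + 1) (by omega) (by omega) (by omega)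
          rw [sub_add_cancel, add_sub_cancel_right] at this
          exact (ih _ (by omega) (x - 1) (y + 1) rfl).1.trans_lt this
        · have := d1 (x - 1) y (by omega) (by omega) (by omega)
          rw [sub_add_cancel] at this
          exact (ih _ (by omega) (x - 1) y rfl).1.trans_lt this
  exact main _ x y rfl

/-- Local strict convexity of `ω` across all edges of the honeycomb triangulation. -/
def HoneycombConvex (ω : (Fin 2 → ℤ) → ℝ) : Prop :=
  ∀ i j : ℤ,
    ω ![i - 1, j - 1] + ω ![i, j] > ω ![i - 1, j] + ω ![i, j - 1] ∧
    ω ![i - 1, j] + ω ![i + 1, j - 1] > ω ![i, j - 1] + ω ![i, j] ∧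
    ω ![i, j - 1] + ω ![i - 1, j + 1] > ω ![i - 1, j] + ω ![i, j]

/-- Local convexity is global: every lattice triangle is cut out by a supporting functional. -/
theorem HoneycombConvex.exists_tiltedArgmin_eq_range {ω : (Fin 2 → ℤ) → ℝ}
    (hω : HoneycombConvex ω) (a : Fin 2 → ℤ) {ε : ℤ} (hε : ε = 1 ∨ ε = -1) :
    ∃ c, tiltedArgmin ω c = Set.range (triangleVertex a ε) := by
  set A := ω (triangleVertex a ε 0) with hA
  set B := ω (triangleVertex a ε 1) with hB
  set C := ω (triangleVertex a ε 2) with hC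
  -- `ω` minus its affine interpolation, in coordinates making the triangle standard. For `ε = -1`
  -- this is a point reflection, which preserves the three inequalities.
  set g : ℤ → ℤ → ℝ := fun x y =>
    ω ![a 0 + ε * x, a 1 + ε * y] - A - x * (B - A) - y * (C - A) with hg
  have ea : a = ![a 0, a 1] := by
    ext i; fin_cases i <;> rfl
  have hpos : ∀ x y, 0 ≤ g x y ∧
      (¬(x = 0 ∧ y = 0) → ¬(x = 1 ∧ y = 0) → ¬(x = 0 ∧ y = 1) → 0 < g x y) := by
    intro x y
    apply pos_of_honeycomb_convex
    · intro i j
      rcases hε with rfl | rfl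
      · have := (hω (a 0 + i) (a 1 + j)).1
        simp only [hg, one_mul, ← add_sub_assoc]
        push_cast
        linarith
      · have := (hω (a 0 - i + 1) (a 1 - j + 1)).1
        simp only [add_sub_cancel_right] at this
        simp only [hg, neg_one_mul, ← sub_eq_add_neg]
        rw [show a 0 - (i - 1) = a 0 - i + 1 by ring, show a 1 - (j - 1) = a 1 - j + 1 by ring]
        push_cast
        linarith
    · intro i j
      rcases hε with rfl | rfl
      · have := (hω (a 0 + i) (a 1 + j)).2.1
        simp only [hg, one_mul, ← add_sub_assoc, ← add_assoc]
        push_cast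
        linarith
      · have := (hω (a 0 - i) (a 1 - j + 1)).2.1
        simp only [add_sub_cancel_right] at this
        simp only [hg, neg_one_mul, ← sub_eq_add_neg]
        rw [show a 0 - (i - 1) = a 0 - i + 1 by ring, show a 1 - (j - 1) = a 1 - j + 1 by ring,
          show a 0 - (i + 1) = a 0 - i - 1 by ring]
        push_cast
        linarith
    · intro i j
      rcases hε with rfl | rfl
      · have := (hω (a 0 + i) (a 1 + j)).2.2
        simp only [hg, one_mul, ← add_sub_assoc, ← add_assoc]
        push_cast
        linarith
      · have := (hω (a 0 - i + 1) (a 1 - j)).2.2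
        simp only [add_sub_cancel_right] at this
        simp only [hg, neg_one_mul, ← sub_eq_add_neg]
        rw [show a 0 - (i - 1) = a 0 - i + 1 by ring, show a 1 - (j - 1) = a 1 - j + 1 by ring,
          show a 1 - (j + 1) = a 1 - j - 1 by ring]
        push_cast
        linarith
    · simp [hg, hA, triangleVertex, ← ea]
    · simp [hg, hB, triangleVertex]
    · simp [hg, hC, triangleVertex]
  have hε2 : ε * ε = 1 := by rcases hε with rfl | rfl <;> rfl
  have hεR : (ε : ℝ) * ε = 1 := by exact_mod_cast hε2
  -- Minus the linear part of the interpolation.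
  set c : (Fin 2 → ℝ) →ₗ[ℝ] ℝ := (-(ε * (B - A))) • LinearMap.proj 0 +
    (-(ε * (C - A))) • LinearMap.proj 1 with hc
  have hval : ∀ b : Fin 2 → ℤ, c (latticePoint b) + ω b =
      g (ε * (b 0 - a 0)) (ε * (b 1 - a 1)) + (A - ε * a 0 * (B - A) - ε * a 1 * (C - A)) := by
    intro b
    have e0 : a 0 + ε * (ε * (b 0 - a 0)) = b 0 := by rw [← mul_assoc, hε2]; ring
    have e1 : a 1 + ε * (ε * (b 1 - a 1)) = b 1 := by rw [← mul_assoc, hε2]; ring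
    have eb : ![b 0, b 1] = b := by ext i; fin_cases i <;> rfl
    simp only [hg, e0, e1, eb, hc, LinearMap.add_apply, LinearMap.smul_apply, LinearMap.proj_apply,
      latticePoint, smul_eq_mul]
    push_cast
    ring
  have hvert : ∀ k, g (ε * (triangleVertex a ε k 0 - a 0)) (ε * (triangleVertex a ε k 1 - a 1))
      = 0 := by
    intro k
    fin_cases k <;> simp [triangleVertex, hε2, hg, hA, hB, hC, ← ea]
  refine ⟨c, ?_⟩
  ext b
  simp only [tiltedArgmin, Set.mem_ofPred_eq, Set.mem_range, hval, add_le_add_iff_right]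
  constructor
  · intro h
    have h0 := h (triangleVertex a ε 0)
    rw [hvert] at h0
    have hcases : (ε * (b 0 - a 0) = 0 ∧ ε * (b 1 - a 1) = 0) ∨
        (ε * (b 0 - a 0) = 1 ∧ ε * (b 1 - a 1) = 0) ∨
        (ε * (b 0 - a 0) = 0 ∧ ε * (b 1 - a 1) = 1) := by
      by_contra hne
      rw [not_or, not_or] at hne
      exact absurd ((hpos _ _).2 hne.1 hne.2.1 hne.2.2) (not_lt.2 h0)
    rcases hcases with h | h | h
    · refine ⟨0, ?_⟩
      ext j
      rcases hε with rfl | rfl <;> fin_cases j <;> simp [triangleVertex] <;> omega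
    · refine ⟨1, ?_⟩
      ext j
      rcases hε with rfl | rfl <;> fin_cases j <;> simp [triangleVertex] <;> omega
    · refine ⟨2, ?_⟩
      ext j
      rcases hε with rfl | rfl <;> fin_cases j <;> simp [triangleVertex] <;> omega
  · rintro ⟨k, rfl⟩ b
    rw [hvert]
    exact (hpos _ _).1

/-! ### Argmin sets are exactly the triangle faces -/

/-- The corner of the lattice triangle adjacent to `triangleVertex a ε` across the edge opposite to
its `i`-th vertex. -/
def adjacentCorner (a : Fin 2 → ℤ) (ε : ℤ) : Fin 3 → Fin 2 → ℤ :=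
  ![![a 0 + ε, a 1 + ε], ![a 0, a 1 + ε], ![a 0 + ε, a 1]]

theorem triangleVertex_mem_range_adjacent_iff (a : Fin 2 → ℤ) {ε : ℤ} (hε : ε = 1 ∨ ε = -1)
    (i k : Fin 3) :
    triangleVertex a ε k ∈ Set.range (triangleVertex (adjacentCorner a ε i) (-ε)) ↔ k ≠ i := by
  rcases hε with rfl | rfl <;> fin_cases i <;> fin_cases k <;>
    simp [triangleVertex, adjacentCorner, funext_iff, Fin.forall_fin_succ]

/-- Intersecting with the triangle across the edge opposite a vertex removes just that vertex. The
vertices outside `I` are removed one at a time; `i₀` keeps the intersection nonempty for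
`tiltedArgmin_inter`. -/
theorem HoneycombConvex.exists_tiltedArgmin_eq_face {ω : (Fin 2 → ℤ) → ℝ}
    (hω : HoneycombConvex ω) (a : Fin 2 → ℤ) {ε : ℤ} (hε : ε = 1 ∨ ε = -1) (I : Set (Fin 3))
    (hI : I.Nonempty) : ∃ c, tiltedArgmin ω c = triangleVertex a ε '' I := by
  classical
  obtain ⟨i₀, hi₀⟩ := hI
  have main : ∀ J : Finset (Fin 3), i₀ ∉ J →
      ∃ c, tiltedArgmin ω c = triangleVertex a ε '' {k | k ∉ J} := by
    intro J
    induction J using Finset.induction_on with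
    | empty =>
      intro _
      simpa using hω.exists_tiltedArgmin_eq_range a hε
    | insert i J hi ih =>
      intro h
      rw [Finset.mem_insert, not_or] at h
      obtain ⟨c, hc⟩ := ih h.2
      obtain ⟨c', hc'⟩ := hω.exists_tiltedArgmin_eq_range (adjacentCorner a ε i) (ε := -ε)
        (by omega)
      have e : tiltedArgmin ω c ∩ tiltedArgmin ω c' =
          triangleVertex a ε '' {k | k ∉ insert i J} := by
        rw [hc, hc']
        ext b
        constructor
        · rintro ⟨⟨k, hk, rfl⟩, hb⟩
          rw [triangleVertex_mem_range_adjacent_iff a hε] at hb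
          exact ⟨k, by simpa [hb] using hk, rfl⟩
        · rintro ⟨k, hk, rfl⟩
          simp only [Set.mem_ofPred_eq, Finset.mem_insert, not_or] at hk
          exact ⟨⟨k, hk.2, rfl⟩, (triangleVertex_mem_range_adjacent_iff a hε i k).2 hk.1⟩
      refine ⟨_, (tiltedArgmin_inter ω c c' ?_).trans e⟩
      rw [e]
      exact ⟨_, i₀, by simpa using h, rfl⟩
  obtain ⟨c, hc⟩ := main (Finset.univ.filter (· ∉ I)) (by simpa using hi₀)
  exact ⟨c, by simpa using hc⟩

/-- Finitely many minimizers of a tilted height lie in a common lattice triangle. -/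
theorem HoneycombConvex.exists_triangle_of_finset {ω : (Fin 2 → ℤ) → ℝ}
    (hω : HoneycombConvex ω) (c : (Fin 2 → ℝ) →ₗ[ℝ] ℝ) (F : Finset (Fin 2 → ℤ))
    (hF : F.Nonempty) (hFc : (F : Set (Fin 2 → ℤ)) ⊆ tiltedArgmin ω c) :
    ∃ (a : Fin 2 → ℤ) (ε : ℤ), (ε = 1 ∨ ε = -1) ∧
      (F : Set (Fin 2 → ℤ)) ⊆ Set.range (triangleVertex a ε) := by
  have hN : (0 : ℝ) < F.card := by exact_mod_cast hF.card_pos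
  set p : Fin 2 → ℝ := (F.card : ℝ)⁻¹ • ∑ b ∈ F, latticePoint b with hp
  obtain ⟨a, ε, hε, hw⟩ := exists_triangleCoord_nonneg p
  obtain ⟨c', hc'⟩ := hω.exists_tiltedArgmin_eq_range a hε
  refine ⟨a, ε, hε, ?_⟩
  set w := triangleCoord a ε p
  set v := triangleVertex a ε
  have hsum : ∑ k, w k = 1 := sum_triangleCoord a ε p
  have hpF : (F.card : ℝ) • p = ∑ b ∈ F, latticePoint b := by
    rw [hp, smul_smul, mul_inv_cancel₀ hN.ne', one_smul]
  have hlin : ∀ f : (Fin 2 → ℝ) →ₗ[ℝ] ℝ,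
      (F.card : ℝ) * ∑ k, w k * f (latticePoint (v k)) = ∑ b ∈ F, f (latticePoint b) := by
    intro f
    rw [← map_sum, ← hpF, map_smul, smul_eq_mul]
    conv_rhs => rw [← sum_triangleCoord_smul a hε p]
    simp [map_sum, w, v]
  obtain ⟨b₀, hb₀⟩ := hF
  have hm : ∀ b ∈ F, c (latticePoint b) + ω b = c (latticePoint b₀) + ω b₀ := fun b hb =>
    le_antisymm (hFc hb b₀) (hFc hb₀ b)
  have hv : ∀ k, v k ∈ tiltedArgmin ω c' := fun k => hc' ▸ ⟨k, rfl⟩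
  have hm' : ∀ k, c' (latticePoint (v k)) + ω (v k) = c' (latticePoint (v 0)) + ω (v 0) :=
    fun k => le_antisymm (hv k (v 0)) (hv 0 (v k))
  -- Both `F` and the triangle represent `p`. Minimality of `F` for `c` bounds its mean height by
  -- that of the triangle; minimality of the triangle for `c'` gives the reverse, so equality holds
  -- termwise.
  have hle : ∑ b ∈ F, ω b ≤ F.card * ∑ k, w k * ω (v k) := by
    have h1 : c (latticePoint b₀) + ω b₀ ≤ ∑ k, w k * (c (latticePoint (v k)) + ω (v k)) := by
      calc c (latticePoint b₀) + ω b₀ = ∑ k, w k * (c (latticePoint b₀) + ω b₀) := by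
            rw [← Finset.sum_mul, hsum, one_mul]
        _ ≤ _ := Finset.sum_le_sum fun k _ => mul_le_mul_of_nonneg_left (hFc hb₀ (v k)) (hw k)
    have h2 := Finset.sum_congr rfl hm
    rw [Finset.sum_add_distrib, ← hlin c, Finset.sum_const, nsmul_eq_mul] at h2
    simp only [mul_add, Finset.sum_add_distrib] at h1
    have h3 := mul_le_mul_of_nonneg_left h1 hN.le
    linarith
  have hsum' : ∑ b ∈ F, (c' (latticePoint b) + ω b) ≤
      ∑ b ∈ F, (c' (latticePoint (v 0)) + ω (v 0)) := by
    have h2 : ∑ k, w k * (c' (latticePoint (v k)) + ω (v k)) =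
        c' (latticePoint (v 0)) + ω (v 0) := by
      simp only [hm', ← Finset.sum_mul, hsum, one_mul]
    rw [Finset.sum_add_distrib, ← hlin c', Finset.sum_const, nsmul_eq_mul, ← h2]
    simp only [mul_add, Finset.sum_add_distrib] at hle ⊢
    linarith
  have hall := (Finset.sum_eq_sum_iff_of_le fun b _ => hv 0 b).1
    (le_antisymm (Finset.sum_le_sum fun b _ => hv 0 b) hsum')
  intro b hb
  rw [← hc']
  intro b'
  rw [← hall b hb]
  exact hv 0 b'

theorem HoneycombConvex.tiltedArgmin_eq_face {ω : (Fin 2 → ℤ) → ℝ}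
    (hω : HoneycombConvex ω) (c : (Fin 2 → ℝ) →ₗ[ℝ] ℝ) (hc : (tiltedArgmin ω c).Nonempty) :
    ∃ (a : Fin 2 → ℤ) (ε : ℤ) (I : Set (Fin 3)), (ε = 1 ∨ ε = -1) ∧ I.Nonempty ∧
      tiltedArgmin ω c = triangleVertex a ε '' I := by
  classical
  have hfin : (tiltedArgmin ω c).Finite := by
    by_contra hinf
    -- Four minimizers cannot all be vertices of one triangle.
    obtain ⟨F, hF, hcard⟩ := Set.Infinite.exists_subset_card_eq hinf 4
    obtain ⟨a, ε, -, hsub⟩ := hω.exists_triangle_of_finset c F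
      (Finset.card_pos.1 (by omega)) hF
    have h1 : F ⊆ Finset.univ.image (triangleVertex a ε) := fun b hb => by
      simpa using hsub hb
    have h2 := (Finset.card_le_card h1).trans Finset.card_image_le
    simp at h2
    omega
  obtain ⟨a, ε, hε, hsub⟩ := hω.exists_triangle_of_finset c hfin.toFinset
    (by simpa using hc) (by simp)
  rw [Set.Finite.coe_toFinset, ← Set.image_univ] at hsub
  obtain ⟨I, -, hI⟩ := Set.subset_image_iff.1 hsub
  refine ⟨a, ε, I, hε, ?_, hI.symm⟩
  rw [← hI] at hc
  exact Set.image_nonempty.1 hc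

/-! ### The two implications -/

theorem HoneycombConvex.induces {ω : (Fin 2 → ℤ) → ℝ} (hω : HoneycombConvex ω) :
    Induces ω honeycombTriangulation := by
  ext S
  rw [mem_regularSubdivision_iff, mem_honeycombTriangulation_iff]
  constructor
  · rintro ⟨c, hc, rfl⟩
    obtain ⟨a, ε, I, hε, hI, h⟩ := hω.tiltedArgmin_eq_face c hc
    exact ⟨a, ε, I, hε, hI, by rw [h]⟩
  · rintro ⟨a, ε, I, hε, hI, rfl⟩
    obtain ⟨c, h⟩ := hω.exists_tiltedArgmin_eq_face a hε I hI
    exact ⟨c, h ▸ hI.image _, by rw [h]⟩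

theorem HoneycombConvex.of_induces {ω : (Fin 2 → ℤ) → ℝ}
    (h : Induces ω honeycombTriangulation) : HoneycombConvex ω := by
  have hS : ∀ (a : Fin 2 → ℤ) (k l : Fin 3),
      convexHull ℝ (latticePoint '' (triangleVertex a 1 '' {k, l})) ∈ regularSubdivision ω := by
    intro a k l
    rw [h, mem_honeycombTriangulation_iff]
    exact ⟨a, 1, {k, l}, Or.inl rfl, ⟨k, by simp⟩, rfl⟩
  intro i j
  refine ⟨?_, ?_, ?_⟩
  · have := lt_of_edge_mem_regularSubdivision (hS ![i - 1, j - 1] 2 1)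
      (x := ![i - 1, j - 1]) (y := ![i, j]) (by simp [triangleVertex]; omega)
      (by simp [triangleVertex, add_comm])
    simpa [triangleVertex] using this
  · have := lt_of_edge_mem_regularSubdivision (hS ![i, j - 1] 0 2)
      (x := ![i - 1, j]) (y := ![i + 1, j - 1]) (by simp [triangleVertex]; omega)
      (by simp [triangleVertex]; omega)
    simpa [triangleVertex] using this
  · have := lt_of_edge_mem_regularSubdivision (hS ![i - 1, j] 0 1)
      (x := ![i, j - 1]) (y := ![i - 1, j + 1]) (by simp [triangleVertex]; omega)
      (by simp [triangleVertex]; omega)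
    simpa [triangleVertex] using this

theorem mainTheorem5 (ω : (Fin 2 → ℤ) → ℝ) :
    Induces ω honeycombTriangulation ↔
      ∀ i j : ℤ,
        ω ![i - 1, j - 1] + ω ![i, j] > ω ![i - 1, j] + ω ![i, j - 1] ∧
        ω ![i - 1, j] + ω ![i + 1, j - 1] > ω ![i, j - 1] + ω ![i, j] ∧
        ω ![i, j - 1] + ω ![i - 1, j + 1] > ω ![i - 1, j] + ω ![i, j] :=
  ⟨fun h => HoneycombConvex.of_induces h, fun h => HoneycombConvex.induces h⟩
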